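/- Let $R=\mathbb{C}[x_0,\dots,x_4]$ and let $T\in R_4=S^4\mathbb{C}^5$ be a quartic form. For a point $P=[a_0:\dots:a_4]\in\mathbb{P}^4$ put $v_d(P)=[(a_0x_0+\dots+a_4x_4)^d]$. A finite set $A\subset\mathbb{P}^4$ computes $T$ if $T$ lies in the linear span of $v_4(A)$; it is a non-redundant decomposition of $T$ if moreover no proper subset of $A$ computes $T$. Write $\ell(A)$ for the cardinality of $A$, $k_d(A)$ for its $d$-th Kruskal rank (the largest $k\le\ell(A)$ such that $v_d(A')$ is linearly independent for every $A'\subset A$ with at most $k$ points), and $(I_A)_2$ for the space of quadratic forms vanishing on $A$. Let $A,B\subset\mathbb{P}^4$ be disjoint finite sets with $\ell(B)\le\ell(A)$ such that $B$ is a non-redundant decomposition of $T$ and $A$ satisfies: (i) $A$ is a non-redundant decomposition of $T$; (ii) $k_1(A)=5$; (iii) $k_2(A)=\ell(A)$. Then $\ell(B)=\ell(A)$. Moreover $(I_{A\cup B})_2=(I_A)_2$; consequently $B$ is contained in the base locus of the linear system of quadrics passing through $A$. -/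

import Mathlib

open MvPolynomial

noncomputable section

/-- The complex projective space `ℙⁿ`, a point of which is the class `[a₀ : … : aₙ]` of a nonzero
vector, identified with the class of the linear form `a₀x₀ + … + aₙxₙ`. -/
abbrev ProjSpace (n : ℕ) : Type := Projectivization ℂ (Fin (n + 1) → ℂ)

/-- The linear form `a₀x₀ + … + aₙxₙ` in `R = ℂ[x₀, …, xₙ]`. -/
def linearForm {n : ℕ} (a : Fin (n + 1) → ℂ) : MvPolynomial (Fin (n + 1)) ℂ :=
  ∑ i, C (a i) * X i

/-- A representative, in the vector space of forms of degree `d`, of the image `v_d(P)` of the point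
`P` under the Veronese embedding. -/
def veroneseVec {n : ℕ} (d : ℕ) (P : ProjSpace n) : MvPolynomial (Fin (n + 1)) ℂ :=
  linearForm P.rep ^ d

/-- Up to a nonzero scalar, `veroneseVec d P` does not depend on the choice of homogeneous
coordinates of `P`; hence neither do the linear spans and the linear (in)dependence below. -/
theorem veroneseVec_mk {n : ℕ} (d : ℕ) (a : Fin (n + 1) → ℂ) (ha : a ≠ 0) :
    ∃ c : ℂˣ, c • veroneseVec d (Projectivization.mk ℂ a ha : ProjSpace n) = linearForm a ^ d := by
  obtain ⟨c, hc⟩ := Projectivization.exists_smul_eq_mk_rep ℂ a ha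
  refine ⟨(c⁻¹) ^ d, ?_⟩
  have h : linearForm (Projectivization.mk ℂ a ha).rep = C (c : ℂ) * linearForm a := by
    rw [← hc]
    simp [linearForm, Finset.mul_sum, Units.smul_def, mul_assoc]
  rw [veroneseVec, h, mul_pow, Units.smul_def, MvPolynomial.smul_eq_C_mul, ← mul_assoc, ← C_pow,
    ← C_mul]
  simp

/-- `A` computes `T` (is a decomposition of `T`) if `T` lies in the linear span of `v_d(A)`. -/
def Computes {n : ℕ} (d : ℕ) (T : MvPolynomial (Fin (n + 1)) ℂ) (A : Finset (ProjSpace n)) : Prop :=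
  T ∈ Submodule.span ℂ (veroneseVec d '' (A : Set (ProjSpace n)))

/-- `A` is a non-redundant decomposition of `T`: it computes `T` and no proper subset of `A`
computes `T`. -/
def IsNonRedundant {n : ℕ} (d : ℕ) (T : MvPolynomial (Fin (n + 1)) ℂ) (A : Finset (ProjSpace n)) :
    Prop :=
  Computes d T A ∧ ∀ A' : Finset (ProjSpace n), A' ⊂ A → ¬ Computes d T A'

/-- The `d`-th Kruskal rank `k_d(A)`: the largest `k ≤ ℓ(A)` such that for every subset `A'` of `A`
with at most `k` points, the points of `v_d(A')` are linearly independent. -/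
def kruskalRank {n : ℕ} (d : ℕ) (A : Finset (ProjSpace n)) : ℕ :=
  sSup {k : ℕ | k ≤ A.card ∧ ∀ A' : Finset (ProjSpace n), A' ⊆ A → A'.card ≤ k →
    LinearIndependent ℂ (fun P : A' => veroneseVec d (P : ProjSpace n))}

/-- The affine cone (without its vertex) over a set of points of `ℙⁿ`: all homogeneous coordinate
vectors of its points. -/
def coneOver {n : ℕ} (Z : Set (ProjSpace n)) : Set (Fin (n + 1) → ℂ) :=
  {a | ∃ ha : a ≠ 0, Projectivization.mk ℂ a ha ∈ Z}

/-- The homogeneous ideal `I_Z` of `Z ⊆ ℙⁿ` in `R = ℂ[x₀, …, xₙ]`: the polynomials that vanish at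
all homogeneous coordinate vectors of all points of `Z`. -/
def projIdeal {n : ℕ} (Z : Set (ProjSpace n)) : Ideal (MvPolynomial (Fin (n + 1)) ℂ) :=
  vanishingIdeal ℂ (coneOver Z)

/-- The homogeneous piece `(I_Z)_j` of degree `j`: the forms of degree `j` vanishing on `Z`. -/
def projIdealPiece {n : ℕ} (Z : Set (ProjSpace n)) (j : ℕ) :
    Submodule ℂ (MvPolynomial (Fin (n + 1)) ℂ) :=
  (projIdeal Z).restrictScalars ℂ ⊓ homogeneousSubmodule (Fin (n + 1)) ℂ j

/-- The base locus of the linear system of quadric hypersurfaces passing through `Z`: the points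
of `ℙⁿ` at which all quadratic forms in `I_Z` vanish. -/
def quadricBaseLocus {n : ℕ} (Z : Set (ProjSpace n)) : Set (ProjSpace n) :=
  {P | ∀ F ∈ projIdealPiece Z 2, eval P.rep F = 0}

end

/-!
The proof is the catalecticant (apolarity) argument in degrees `4 = 2 + 2`. Write
`T = ∑_{P ∈ A} c_P L_P⁴ = ∑_{Q ∈ B} c'_Q L_Q⁴`. Contracting with a quadratic form `q`, acting as a
differential operator, and dividing by `12` gives
`∑_{P ∈ A} c_P q(P) L_P² = ∑_{Q ∈ B} c'_Q q(Q) L_Q²` (`sum_eval_smul_veroneseVec`).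

If `q` vanishes on `B`, the right-hand side is zero. As `k₂(A) = ℓ(A)`, the squares `L_P²` are
linearly independent, so `c_P q(P) = 0` for all `P ∈ A`; and `c_P ≠ 0` because `A` is non-redundant.
Thus every quadric through `B` passes through `A` (`projIdealPiece_le_of_computes`).

Independence of the squares also says that `A` imposes `ℓ(A)` independent conditions on quadrics
(`evalForms_surjective`), whereas `B` imposes at most `ℓ(B) ≤ ℓ(A)` conditions. The inclusion
`(I_B)₂ ⊆ (I_A)₂` then forces `ℓ(B) = ℓ(A)` and `(I_B)₂ = (I_A)₂` by counting dimensions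
(`card_eq_and_projIdealPiece_eq`).
-/

open MvPolynomial

variable {n : ℕ}

theorem isHomogeneous_linearForm (a : Fin (n + 1) → ℂ) : (linearForm a).IsHomogeneous 1 :=
  IsHomogeneous.sum _ _ _ fun i _ => isHomogeneous_C_mul_X (a i) i

theorem eval_linearForm (a b : Fin (n + 1) → ℂ) : eval b (linearForm a) = ∑ i, a i * b i := by
  simp [linearForm]

theorem eval_linearForm_comm (a b : Fin (n + 1) → ℂ) :
    eval b (linearForm a) = eval a (linearForm b) := by
  simp only [eval_linearForm, mul_comm]

theorem pderiv_linearForm (a : Fin (n + 1) → ℂ) (i : Fin (n + 1)) :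
    pderiv i (linearForm a) = C (a i) := by
  simp [linearForm, pderiv_X, Pi.single_apply]

theorem pderiv_veroneseVec_succ (d : ℕ) (P : ProjSpace n) (i : Fin (n + 1)) :
    pderiv i (veroneseVec (d + 1) P) = ((d + 1 : ℂ) * P.rep i) • veroneseVec d P := by
  rw [veroneseVec, pderiv_pow, pderiv_linearForm, veroneseVec, smul_eq_C_mul, C_mul]
  simp
  ring

/-- Contraction of a relation between powers of linear forms with a form `q` of degree `e`, by
induction on `e`: contracting with a variable is a partial derivative up to a scalar. -/
theorem sum_eval_smul_veroneseVec {A B : Finset (ProjSpace n)} {e : ℕ}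
    {q : MvPolynomial (Fin (n + 1)) ℂ} (hq : q.IsHomogeneous e) :
    ∀ {d : ℕ} {c c' : ProjSpace n → ℂ},
      ∑ P ∈ A, c P • veroneseVec (d + e) P = ∑ P ∈ B, c' P • veroneseVec (d + e) P →
      ∑ P ∈ A, (c P * eval P.rep q) • veroneseVec d P =
        ∑ P ∈ B, (c' P * eval P.rep q) • veroneseVec d P := by
  have hq' : q ∈ homogeneousSubmodule (Fin (n + 1)) ℂ 1 ^ e := by
    rwa [homogeneousSubmodule_one_pow]
  clear hq
  induction hq' using Submodule.pow_induction_on_left' with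
  | algebraMap r =>
    intro d c c' h
    simp only [algebraMap_eq, eval_C, mul_comm _ r, mul_smul, ← Finset.smul_sum]
    exact congrArg (r • ·) h
  | add x y i _ _ hx hy =>
    intro d c c' h
    simp only [map_add, mul_add, add_smul, Finset.sum_add_distrib, hx h, hy h]
  | mem_mul m hm i x _ ih =>
    intro d c c' h
    have h' := ih (d := d + 1) (c := c) (c' := c') (by rwa [Nat.add_right_comm, Nat.add_assoc])
    rw [homogeneousSubmodule_one_eq_span_X] at hm
    induction hm using Submodule.span_induction with
    | mem m hm =>
      obtain ⟨j, rfl⟩ := hm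
      -- `∂ⱼ L_P ^ (d + 1) = (d + 1) P_j L_P ^ d`, and `d + 1` is invertible in characteristic zero.
      have hd : (d + 1 : ℂ) ≠ 0 := Nat.cast_add_one_ne_zero d
      apply smul_right_injective _ hd
      simpa [pderiv_veroneseVec_succ, Finset.smul_sum, smul_smul, mul_comm, mul_left_comm,
        mul_assoc] using congrArg (pderiv j) h'
    | zero => simp
    | add m m' _ _ hm hm' =>
      simp only [map_add, add_mul, mul_add, add_smul, Finset.sum_add_distrib] at hm hm' ⊢
      rw [hm, hm']
    | smul r m _ hm =>
      simp only [smul_mul_assoc, smul_eval, mul_left_comm _ r, mul_smul, ← Finset.smul_sum]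
        at hm ⊢
      rw [hm]

theorem computes_iff {d : ℕ} {T : MvPolynomial (Fin (n + 1)) ℂ} {A : Finset (ProjSpace n)} :
    Computes d T A ↔ ∃ c : ProjSpace n → ℂ, ∑ P ∈ A, c P • veroneseVec d P = T :=
  Submodule.mem_span_image_finset_iff_exists_fun' ℂ

theorem IsNonRedundant.coeff_ne_zero {d : ℕ} {T : MvPolynomial (Fin (n + 1)) ℂ}
    {A : Finset (ProjSpace n)} (hA : IsNonRedundant d T A) {c : ProjSpace n → ℂ}
    (hc : ∑ P ∈ A, c P • veroneseVec d P = T) {P : ProjSpace n} (hP : P ∈ A) : c P ≠ 0 := by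
  classical
  intro h
  refine hA.2 _ (Finset.erase_ssubset hP) (computes_iff.2 ⟨c, ?_⟩)
  rw [← hc, ← Finset.add_sum_erase A _ hP, h, zero_smul, zero_add]

/-- The supremum defining the Kruskal rank is attained, the set being bounded and containing `0`. -/
theorem linearIndependent_of_kruskalRank_eq_card {d : ℕ} {A : Finset (ProjSpace n)}
    (hA : kruskalRank d A = A.card) :
    LinearIndependent ℂ (fun P : A => veroneseVec d (P : ProjSpace n)) := by
  have h := Nat.sSup_mem (s := {k : ℕ | k ≤ A.card ∧ ∀ A' : Finset (ProjSpace n), A' ⊆ A →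
      A'.card ≤ k → LinearIndependent ℂ (fun P : A' => veroneseVec d (P : ProjSpace n))})
    ⟨0, Nat.zero_le _, fun A' _ h0 => ?_⟩ ⟨A.card, fun k hk => hk.1⟩
  · exact h.2 A subset_rfl hA.ge
  · obtain rfl : A' = ∅ := Finset.card_eq_zero.1 (Nat.le_zero.1 h0)
    exact linearIndependent_empty_type

theorem eval_smul_of_isHomogeneous {q : MvPolynomial (Fin (n + 1)) ℂ} {j : ℕ}
    (hq : q.IsHomogeneous j) (r : ℂ) (a : Fin (n + 1) → ℂ) :
    eval (r • a) q = r ^ j * eval a q := by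
  rw [eval_eq, eval_eq, Finset.mul_sum]
  refine Finset.sum_congr rfl fun s hs => ?_
  simp only [Pi.smul_apply, smul_eq_mul, mul_pow, Finset.prod_mul_distrib,
    Finset.prod_pow_eq_pow_sum, ← hq.degree_eq_sum_deg_support hs]
  ring

/-- For forms, vanishing on the cone over `Z` can be tested on the chosen representatives. -/
theorem mem_projIdealPiece {Z : Set (ProjSpace n)} {j : ℕ} {q : MvPolynomial (Fin (n + 1)) ℂ} :
    q ∈ projIdealPiece Z j ↔ q.IsHomogeneous j ∧ ∀ P ∈ Z, eval P.rep q = 0 := by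
  have key : q ∈ projIdealPiece Z j ↔ (∀ a ∈ coneOver Z, eval a q = 0) ∧ q.IsHomogeneous j :=
    Iff.rfl
  rw [key, and_comm]
  refine and_congr_right fun hq => ⟨fun h P hP => h _ ⟨P.rep_nonzero, by rwa [P.mk_rep]⟩, ?_⟩
  rintro h a ⟨ha, hP⟩
  obtain ⟨c, hc⟩ := Projectivization.exists_smul_eq_mk_rep ℂ a ha
  have h0 := h _ hP
  rw [← hc, Units.smul_def, eval_smul_of_isHomogeneous hq] at h0
  exact (mul_eq_zero.1 h0).resolve_left (pow_ne_zero _ c.ne_zero)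

/-- Every form of degree `e` vanishing on a decomposition of `T` vanishes on a non-redundant
decomposition `A` whose `d`-th powers are linearly independent. -/
theorem projIdealPiece_le_of_computes {d e : ℕ} {T : MvPolynomial (Fin (n + 1)) ℂ}
    {A B : Finset (ProjSpace n)} (hA : IsNonRedundant (d + e) T A) (hB : Computes (d + e) T B)
    (hind : LinearIndependent ℂ (fun P : A => veroneseVec d (P : ProjSpace n))) :
    projIdealPiece (B : Set (ProjSpace n)) e ≤ projIdealPiece (A : Set (ProjSpace n)) e := by
  intro q hq
  rw [mem_projIdealPiece] at hq ⊢
  obtain ⟨c, hc⟩ := computes_iff.1 hA.1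
  obtain ⟨c', hc'⟩ := computes_iff.1 hB
  have h := (sum_eval_smul_veroneseVec hq.1 (hc.trans hc'.symm)).trans <|
    Finset.sum_eq_zero fun P hP => by rw [hq.2 P hP, mul_zero, zero_smul]
  rw [← Finset.sum_coe_sort] at h
  refine ⟨hq.1, fun P hP => ?_⟩
  exact (mul_eq_zero.1 (Fintype.linearIndependent_iff.1 hind
    (fun P => c P * eval (P : ProjSpace n).rep q) h ⟨P, hP⟩)).resolve_left
    (hA.coeff_ne_zero hc hP)

/-- Evaluation of the forms of degree `e` at the chosen representatives of the points of `A`. -/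
noncomputable def evalForms (e : ℕ) (A : Finset (ProjSpace n)) :
    homogeneousSubmodule (Fin (n + 1)) ℂ e →ₗ[ℂ] (A → ℂ) :=
  LinearMap.pi fun P => (aeval (P : ProjSpace n).rep).toLinearMap ∘ₗ Submodule.subtype _

theorem evalForms_apply (e : ℕ) (A : Finset (ProjSpace n))
    (q : homogeneousSubmodule (Fin (n + 1)) ℂ e) (P : A) :
    evalForms e A q P = eval (P : ProjSpace n).rep (q : MvPolynomial (Fin (n + 1)) ℂ) :=
  rfl

theorem map_ker_evalForms (e : ℕ) (A : Finset (ProjSpace n)) :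
    (LinearMap.ker (evalForms e A)).map (Submodule.subtype _) =
      projIdealPiece (A : Set (ProjSpace n)) e := by
  ext q
  rw [mem_projIdealPiece]
  constructor
  · rintro ⟨q, hq, rfl⟩
    exact ⟨q.2, fun P hP => congrFun hq ⟨P, hP⟩⟩
  · rintro ⟨hq, h⟩
    refine ⟨⟨q, hq⟩, LinearMap.mem_ker.2 ?_, rfl⟩
    ext P
    exact h P P.2

/-- If the `e`-th powers of the linear forms in `A` are linearly independent, then `A` imposes
independent conditions on forms of degree `e`: by the symmetry `L_P(b) = L_b(P)`, a linear relation
`∑ l_P q(P) = 0` valid for all powers `q = L_b ^ e` says that `∑ l_P L_P ^ e` vanishes at every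
`b`. -/
theorem evalForms_surjective {e : ℕ} {A : Finset (ProjSpace n)}
    (hind : LinearIndependent ℂ (fun P : A => veroneseVec e (P : ProjSpace n))) :
    Function.Surjective (evalForms e A) := by
  classical
  rw [← LinearMap.range_eq_top]
  by_contra hne
  obtain ⟨f, hf, hle⟩ := Submodule.exists_le_ker_of_lt_top _ (lt_top_iff_ne_top.2 hne)
  have hfx (x : A → ℂ) : f x = ∑ P, f (Pi.single P 1) * x P := by
    conv_lhs => rw [LinearMap.pi_apply_eq_sum_univ f x]
    refine Finset.sum_congr rfl fun P _ => ?_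
    rw [smul_eq_mul, mul_comm]
    congr 2
    ext Q
    simp [Pi.single_apply, eq_comm]
  have hrel : ∑ P : A, f (Pi.single P 1) • veroneseVec e (P : ProjSpace n) = 0 := by
    refine MvPolynomial.funext fun b => ?_
    have hb : (linearForm b ^ e).IsHomogeneous e := by
      simpa using (isHomogeneous_linearForm b).pow e
    have h0 : f (evalForms e A ⟨_, hb⟩) = 0 := hle ⟨_, rfl⟩
    rw [hfx] at h0
    simpa [evalForms_apply, veroneseVec, smul_eval, eval_linearForm_comm _ b] using h0
  have hz := Fintype.linearIndependent_iff.1 hind _ hrel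
  exact hf (LinearMap.ext fun x => by simp [hfx x, hz])

/-- In even degree `2e` the evaluation maps of `A` and `B` on forms of degree `e` have nested
kernels, that of `A` being onto a space of dimension at least `ℓ(B)`. -/
theorem card_eq_and_projIdealPiece_eq {e : ℕ} {T : MvPolynomial (Fin (n + 1)) ℂ}
    {A B : Finset (ProjSpace n)} (hA : IsNonRedundant (e + e) T A) (hB : Computes (e + e) T B)
    (hind : LinearIndependent ℂ (fun P : A => veroneseVec e (P : ProjSpace n)))
    (hcard : B.card ≤ A.card) :
    B.card = A.card ∧
      projIdealPiece (B : Set (ProjSpace n)) e = projIdealPiece (A : Set (ProjSpace n)) e := by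
  have hle := projIdealPiece_le_of_computes hA hB hind
  have : Module.Finite ℂ (homogeneousSubmodule (Fin (n + 1)) ℂ e) :=
    Module.Finite.iff_fg.2 (homogeneousSubmodule_fg _ _ e)
  rw [← map_ker_evalForms, ← map_ker_evalForms] at hle ⊢
  rw [Submodule.map_le_map_iff_of_injective (Submodule.subtype_injective _)] at hle
  have hrA := (evalForms e A).finrank_range_add_finrank_ker
  have hrB := (evalForms e B).finrank_range_add_finrank_ker
  rw [LinearMap.range_eq_top.2 (evalForms_surjective hind), finrank_top,
    Module.finrank_fintype_fun_eq_card, Fintype.card_coe] at hrA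
  have hB' := (LinearMap.range (evalForms e B)).finrank_le
  rw [Module.finrank_fintype_fun_eq_card, Fintype.card_coe] at hB'
  have hfin := Submodule.finrank_mono hle
  exact ⟨by omega, congrArg _ (Submodule.eq_of_le_of_finrank_eq hle (by omega))⟩

theorem mainTheorem2 (T : MvPolynomial (Fin 5) ℂ) (hT : T.IsHomogeneous 4)
    (A B : Finset (ProjSpace 4))
    (hA : IsNonRedundant 4 T A) (hA1 : kruskalRank 1 A = 5) (hA2 : kruskalRank 2 A = A.card)
    (hB : IsNonRedundant 4 T B) (hdisj : Disjoint A B) (hcard : B.card ≤ A.card) :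
    B.card = A.card ∧
      projIdealPiece ((A : Set (ProjSpace 4)) ∪ (B : Set (ProjSpace 4))) 2 =
        projIdealPiece (A : Set (ProjSpace 4)) 2 ∧
      (B : Set (ProjSpace 4)) ⊆ quadricBaseLocus (A : Set (ProjSpace 4)) := by
  obtain ⟨hc, heq⟩ := card_eq_and_projIdealPiece_eq (e := 2) hA hB.1
    (linearIndependent_of_kruskalRank_eq_card hA2) hcard
  have hvan : ∀ F ∈ projIdealPiece (A : Set (ProjSpace 4)) 2, ∀ P ∈ B, eval P.rep F = 0 :=
    fun F hF => (mem_projIdealPiece.1 (heq.ge hF)).2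
  refine ⟨hc, le_antisymm (fun F hF => ?_) fun F hF => ?_, fun P hP F hF => hvan F hF P hP⟩
  · rw [mem_projIdealPiece] at hF ⊢
    exact ⟨hF.1, fun P hP => hF.2 P (Or.inl hP)⟩
  · have hF' := mem_projIdealPiece.1 hF
    exact mem_projIdealPiece.2 ⟨hF'.1, fun P hP => hP.elim (hF'.2 P) (hvan F hF P)⟩
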